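/- Let $\lambda$ be an infinite regular cardinal. Throughout, a \emph{family} on an object $x$ of a category is a set of arrows with codomain $x$; it is \emph{extremal epimorphic} if it does not factor through any proper subobject of $x$ (in $\mathbf{Set}$: it is jointly surjective). A functor is \emph{$\lambda$-lex} if it preserves limits of diagrams of size $<\lambda$, and \emph{$E$-preserving}, for a collection $E$ of families in its domain, if it maps each $E$-family to an extremal epimorphic family. Let $(\mathcal C,E)$ be a small $\lambda$-site: $\mathcal C$ is a small category with all limits of size $<\lambda$, and $E$ is a set of arbitrary families in $\mathcal C$ which contains the family $\{\mathrm{id}\colon 1\to 1\}$. Let $E^{pb}$ be the set of all pullbacks of $E$-families. A \emph{continuous $(E^{pb},\lambda)$-cotree} is a diagram in $\mathcal C$ indexed by the opposite of a rooted (transfinite, well-founded) tree, such that at each vertex either the cotree stops (the vertex is then maximal in the tree and is called a leaf) or the arrows from its immediate successors in the tree form an $E^{pb}$-family (possibly the empty one), every branch has length $<\lambda$, and the object at each limit point of a branch is the limit of the preceding part of the branch. Let $\langle E\rangle_\lambda$ be the set of all families that consist, for some such cotree, of the projections to the root from the limits of its branches (leaving out the branches that end in a vertex at which the empty family was taken).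 Let $\mathrm{Sh}(\mathcal C,\langle E\rangle_\lambda)$ be the category of sheaves of sets for the Grothendieck topology given by these families, and let $ay\colon\mathcal C\to \mathrm{Sh}(\mathcal C,\langle E\rangle_\lambda)$ be the Yoneda embedding followed by sheafification. Assume that $|E|\le\lambda$ and that $|\mathcal C(x,y)|\le\lambda$ for all objects $x,y$ of $\mathcal C$. Let $(f_i\colon u_i\to x_0)_{i\in I}$ be a family of arrows in $\mathcal C$ such that for every $\lambda$-lex $E$-preserving functor $M\colon\mathcal C\to\mathbf{Set}$ the family $(M(f_i)\colon M(u_i)\to M(x_0))_{i\in I}$ is jointly surjective. Then the family $(ay(f_i)\colon ay(u_i)\to ay(x_0))_{i\in I}$ in $\mathrm{Sh}(\mathcal C,\langle E\rangle_\lambda)$ is extremal epimorphic. -/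

import Mathlib

open CategoryTheory CategoryTheory.Limits

universe u

namespace LexSite

/-! In this file a *family* on an object `X` is a set of arrows with codomain `X`, that is, a
`Presieve X`, and a collection of families is a `Precoverage`. -/

section Lex

/-- `C` has `< κ`-limits: limits of all diagrams whose shape has fewer than `κ` arrows. -/
def IsLexCategory (κ : Cardinal.{u}) (C : Type u) [SmallCategory C] : Prop :=
  ∀ (J : Type u) [SmallCategory J], HasCardinalLT (Arrow J) κ → HasLimitsOfShape J C

/-- The functor `F` preserves `< κ`-limits. -/
def IsLexFunctor (κ : Cardinal.{u}) {C : Type u} [SmallCategory C]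
    {D : Type*} [Category* D] (F : C ⥤ D) : Prop :=
  ∀ (J : Type u) [SmallCategory J], HasCardinalLT (Arrow J) κ →
    Nonempty (PreservesLimitsOfShape J F)

end Lex

section Families

variable {D : Type*} [Category* D]

/-- A family on `X` is extremal epimorphic if it does not factor through a proper subobject
of `X`. (In a category with equalizers such a family is jointly epimorphic.) -/
def IsExtremalEpimorphic {X : D} (R : Presieve X) : Prop :=
  ∀ ⦃Z : D⦄ (m : Z ⟶ X) [Mono m],
    (∀ ⦃Y : D⦄ (f : Y ⟶ X), R f → ∃ g : Y ⟶ Z, g ≫ m = f) → IsIso m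

/-- `F` maps the families in `E` to extremal epimorphic families. -/
def PreservesFamilies {C : Type*} [Category* C] (E : Precoverage C) (F : C ⥤ D) : Prop :=
  ∀ (X : C) (R : Presieve X), R ∈ E X → IsExtremalEpimorphic (R.map F)

end Families

variable {C : Type u} [SmallCategory C]

/-- The family `S` on `X` is a pullback along `g : X ⟶ Y` of the family `R` on `Y`: its arrows are
pullbacks along `g` of arrows in `R`, and each arrow in `R` has such a pullback in `S`. -/
def IsPullbackFamily {X Y : C} (g : X ⟶ Y) (R : Presieve Y) (S : Presieve X) : Prop :=
  (∀ ⦃W : C⦄ (p : W ⟶ X), S p →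
    ∃ (Z : C) (f : Z ⟶ Y) (q : W ⟶ Z), R f ∧ IsPullback p q g f) ∧
  (∀ ⦃Z : C⦄ (f : Z ⟶ Y), R f →
    ∃ (W : C) (p : W ⟶ X) (q : W ⟶ Z), S p ∧ IsPullback p q g f)

/-- `E^{pb}`: the families that are pullbacks of `E`-families. -/
def pullbackClosure (E : Precoverage C) : Precoverage C where
  coverings X := {S | ∃ (Y : C) (g : X ⟶ Y) (R : Presieve Y), R ∈ E Y ∧ IsPullbackFamily g R S}

section Restrict

variable {T : Type u} [PartialOrder T] (D : Tᵒᵖ ⥤ C)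

/-- The restriction of a diagram `Tᵒᵖ ⥤ C` to a subset of `T`. -/
def restrict (s : Set T) : (s)ᵒᵖ ⥤ C :=
  (Subtype.mono_coe (· ∈ s)).functor.op ⋙ D

/-- If `t` is an upper bound of `s`, then `D t` is the apex of a cone over the restriction of `D`
to `s`, with the arrows of `D` as projections. -/
def coneOfUpperBound (s : Set T) (t : T) (ht : t ∈ upperBounds s) : Cone (restrict D s) where
  pt := D.obj (Opposite.op t)
  π :=
    { app := fun x => D.map (homOfLE (ht x.unop.2)).op
      naturality := fun x y f => by
        dsimp [restrict]
        rw [Category.id_comp, ← D.map_comp]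
        rfl }

end Restrict

/-- A continuous `(E, κ)`-cotree in `C`: the opposite `Tᵒᵖ` of a rooted tree `T` (a partial order
with least element `⊥` in which the elements below any given one are well-ordered) as a
diagram `diag` in `C`. Some maximal elements of `T` are marked as leaves, where the construction
of the cotree stops; at every other vertex the arrows from the next vertices form an `E`-family.
(So a maximal vertex that is not a leaf is a vertex at which the empty family is in `E`.)
Every branch has length `< κ`, and the objects at the limit points are limits. -/
structure ContinuousCotree (E : Precoverage C) (κ : Cardinal.{u}) where
  T : Type u
  [partialOrder : PartialOrder T]
  [orderBot : OrderBot T]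
  isChain_Iic : ∀ t : T, IsChain (· ≤ ·) (Set.Iic t)
  wellFounded : WellFoundedLT T
  diag : Tᵒᵖ ⥤ C
  leaf : Set T
  isMax_of_leaf : ∀ t ∈ leaf, IsMax t
  children_mem : ∀ t : T, t ∉ leaf →
    Presieve.ofArrows (fun s : {s : T // t ⋖ s} => diag.obj (Opposite.op s.1))
      (fun s => diag.map (homOfLE s.2.le).op) ∈ E (diag.obj (Opposite.op t))
  branch_lt : ∀ b : Flag T, Cardinal.mk (b : Set T) < κ
  continuous : ∀ t : T, Order.IsSuccLimit t →
    Nonempty (IsLimit (coneOfUpperBound diag (Set.Iio t) t (fun _ hs => le_of_lt hs)))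

namespace ContinuousCotree

attribute [instance] partialOrder orderBot

variable {E : Precoverage C} {κ : Cardinal.{u}} (t : ContinuousCotree E κ)

/-- The object at the root. -/
def root : C := t.diag.obj (Opposite.op ⊥)

/-- The branches which contribute a leg to the transfinite cocomposition: the maximal chains of the
tree that do not end in a vertex at which the empty family was taken. -/
def Branch : Type u := {b : Flag t.T // ∀ x ∈ b, IsMax x → x ∈ t.leaf}

/-- The part of the cotree along a branch. -/
def branchDiagram (b : t.Branch) : ((b.1 : Set t.T))ᵒᵖ ⥤ C := restrict t.diag (b.1 : Set t.T)

/-- The transfinite cocomposition of a branch, for a choice of its limit: the projection from the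
limit of the branch to the root. (If the branch ends in a leaf, this is up to isomorphism the
arrow from the object at the leaf to the root.) -/
def leg (b : t.Branch) (c : LimitCone (t.branchDiagram b)) : c.cone.pt ⟶ t.root :=
  c.cone.π.app (Opposite.op ⟨⊥, b.1.bot_mem⟩)

end ContinuousCotree

/-- The families that consist of the transfinite cocompositions of the branches of a continuous
`(E, κ)`-cotree. -/
inductive IsCotreeFamily (E : Precoverage C) (κ : Cardinal.{u}) : ∀ X : C, Presieve X → Prop
  | mk (t : ContinuousCotree E κ) (c : ∀ b : t.Branch, LimitCone (t.branchDiagram b)) :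
      IsCotreeFamily E κ t.root
        (Presieve.ofArrows (fun b => (c b).cone.pt) (fun b => t.leg b (c b)))

/-- `E^{tree_κ}`: the closure of `E` under the `κ`-tree operation. -/
def treeClosure (κ : Cardinal.{u}) (E : Precoverage C) : Precoverage C where
  coverings X := {R | IsCotreeFamily E κ X R}

/-- `⟨E⟩_κ = (E^{pb})^{tree_κ}`. -/
def closure (κ : Cardinal.{u}) (E : Precoverage C) : Precoverage C :=
  treeClosure κ (pullbackClosure E)

/-- The Grothendieck topology given by the families in `⟨E⟩_κ`. -/
def topology (κ : Cardinal.{u}) (E : Precoverage C) : GrothendieckTopology C :=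
  (closure κ E).toGrothendieck

/-- `ay : C ⥤ Sh(C, ⟨E⟩_κ)`, the Yoneda embedding followed by sheafification. -/
noncomputable def ay (κ : Cardinal.{u}) (E : Precoverage C) :
    C ⥤ Sheaf (topology κ E) (Type u) :=
  yoneda ⋙ presheafToSheaf (topology κ E) (Type u)

/-- `(C, E)` is a (small) `κ`-site, for a regular cardinal `κ`: `C` has `< κ`-limits, and the
collection `E` of families contains the family `{id : 1 ⟶ 1}`. -/
structure IsSite (κ : Cardinal.{u}) (E : Precoverage C) : Prop where
  isRegular : κ.IsRegular
  isLexCategory : IsLexCategory κ C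
  id_mem : ∃ X : C, Nonempty (IsTerminal X) ∧ Presieve.singleton (𝟙 X) ∈ E X

end LexSite

/-! Write λ for `κ` and `S` for the sieve generated by the `f i`. A task for an object `X` is a
family in `E` together with an arrow from `X` to its base. Each object has at most λ tasks, so
bookkeeping over the λ stages below λ can schedule every task of every object met along a run
(`exists_exhaustive_strategy`). A run starts at `x₀`. At a successor stage it passes to a pullback
of some member of the scheduled family, at a limit stage it takes the limit, and it stops once its
arrow to `x₀` lies in `S`.

There are two cases. If no run passes through all λ stages, the runs form a continuous cotree whose
contributing branches all end in leaves. Its legs then lie in `S`, so `S` covers `x₀`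
(`mem_topology_of_forall_not_isRun`), and sheafification makes the family extremal epimorphic
(`isExtremalEpimorphic_of_mem`).

Otherwise a run `D` of full length gives the model colim Hom(`D a`, -). It is λ-lex because λ is
regular (`colimitModel.isLexFunctor`), and it is `E`-preserving because every task is carried out
(`IsRun.preservesFamilies`). By hypothesis the element of the model at `x₀` represented at the root
is hit by some `f i`. Hence some arrow of the run to `x₀` factors through `f i`, and the run should
have stopped there. -/

namespace LexSite

/-! ### Strict extension of diagrams indexed by lower sets -/

section Posets

variable {C : Type u} [SmallCategory C]

/-- The extension of a diagram along `P ↪ WithTop P` that is given by a cone. -/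
def coneExtension {P : Type u} [Preorder P] (D : Pᵒᵖ ⥤ C) (c : Cone D) : (WithTop P)ᵒᵖ ⥤ C where
  obj x := match x.unop with
    | ⊤ => c.pt
    | (p : P) => D.obj (Opposite.op p)
  map {x y} f := match x, y, f with
    | ⟨⊤⟩, ⟨⊤⟩, _ => 𝟙 _
    | ⟨⊤⟩, ⟨(p : P)⟩, _ => c.π.app (Opposite.op p)
    | ⟨(p : P)⟩, ⟨(q : P)⟩, f => D.map (homOfLE (WithTop.coe_le_coe.1 (leOfHom f.unop))).op
    | ⟨(p : P)⟩, ⟨⊤⟩, f => absurd (leOfHom f.unop) (WithTop.not_top_le_coe p)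
  map_id x := by
    match x with
    | ⟨⊤⟩ => rfl
    | ⟨(p : P)⟩ => exact D.map_id _
  map_comp {x y z} f g := by
    match x, y, z, f, g with
    | ⟨⊤⟩, ⟨⊤⟩, ⟨⊤⟩, _, _ => exact (Category.comp_id _).symm
    | ⟨⊤⟩, ⟨⊤⟩, ⟨(p : P)⟩, _, _ => exact (Category.id_comp _).symm
    | ⟨⊤⟩, ⟨(p : P)⟩, ⟨(q : P)⟩, f, g => exact (c.w _).symm
    | ⟨(p : P)⟩, ⟨(q : P)⟩, ⟨(r : P)⟩, f, g => exact D.map_comp _ _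
    | _, ⟨(p : P)⟩, ⟨⊤⟩, _, g => exact absurd (leOfHom g.unop) (WithTop.not_top_le_coe p)
    | ⟨(p : P)⟩, ⟨⊤⟩, _, f, _ => exact absurd (leOfHom f.unop) (WithTop.not_top_le_coe p)

variable {J : Type u} [LinearOrder J]

/-- The restriction of a diagram to a smaller lower set. -/
def restrictLower {s s' : LowerSet J} (h : s ≤ s') (D : (s')ᵒᵖ ⥤ C) : (s)ᵒᵖ ⥤ C :=
  (Monotone.functor (f := fun x : s => (⟨x.1, h x.2⟩ : s')) (fun _ _ hxy => hxy)).op ⋙ D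

open Classical in
/-- Collapse of the part of `s'` outside of `s` to a top element. -/
noncomputable def collapse (s s' : LowerSet J) (x : s') : WithTop s :=
  if h : x.1 ∈ s then ((⟨x.1, h⟩ : s) : WithTop s) else ⊤

lemma collapse_of_mem {s s' : LowerSet J} (x : s') (h : x.1 ∈ s) :
    collapse s s' x = ((⟨x.1, h⟩ : s) : WithTop s) := dif_pos h

lemma collapse_of_notMem {s s' : LowerSet J} (x : s') (h : x.1 ∉ s) :
    collapse s s' x = ⊤ := dif_neg h

lemma collapse_mono (s s' : LowerSet J) : Monotone (collapse s s') := by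
  intro x y hxy
  by_cases hy : y.1 ∈ s
  · rw [collapse_of_mem y hy, collapse_of_mem x (s.lower hxy hy)]
    exact WithTop.coe_le_coe.2 hxy
  · rw [collapse_of_notMem y hy]
    exact le_top

/-- The extension of a diagram on a lower set to a larger one that is given by a cone. -/
noncomputable def extendLower {s : LowerSet J} (D : (s)ᵒᵖ ⥤ C) (c : Cone D) (s' : LowerSet J) :
    (s')ᵒᵖ ⥤ C :=
  (collapse_mono s s').functor.op ⋙ coneExtension D c

lemma functor_op_comp_congr {P Q : Type u} [Preorder P] [Preorder Q] {f g : P → Q}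
    (hf : Monotone f) (hg : Monotone g) (h : f = g) (D : Qᵒᵖ ⥤ C) :
    hf.functor.op ⋙ D = hg.functor.op ⋙ D := by
  subst h
  rfl

/-- On `s` the collapse is the inclusion into `WithTop s`, where `coneExtension` is `D` by
definition. Equality of functors, rather than isomorphism, is what the order on runs requires. -/
lemma restrictLower_extendLower {s s' : LowerSet J} (h : s ≤ s') (D : (s)ᵒᵖ ⥤ C) (c : Cone D) :
    restrictLower h (extendLower D c s') = D :=
  functor_op_comp_congr (f := fun x : s => collapse s s' ⟨x.1, h x.2⟩)
    (g := fun x : s => (x : WithTop s)) (fun _ _ hxy => collapse_mono s s' hxy)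
    (fun _ _ hxy => WithTop.coe_le_coe.2 hxy)
    (funext fun x => collapse_of_mem ⟨x.1, h x.2⟩ x.2) (coneExtension D c)

end Posets

/-! ### Runs of a strategy and their order -/

section Runs

variable {C : Type u} [SmallCategory C]

/-- A member of `E` together with an arrow from `X` along which it can be pulled back. -/
abbrev Task (E : Precoverage C) (X : C) : Type u := Σ R : (Σ Y : C, E Y), (X ⟶ R.1)

/-- In the diagram `D`, the arrow `D c ⟶ D b` is a pullback of an arrow of the family of the task
`t (D a)` along `D b ⟶ D a ⟶ Y`. -/
def IsStep {E : Precoverage C} {Q : Type u} [Preorder Q] (D : Qᵒᵖ ⥤ C) (t : ∀ X, Task E X)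
    {a b c : Q} (hab : a ≤ b) (hbc : b ≤ c) : Prop :=
  ∃ (Z : C) (f : Z ⟶ (t (D.obj (Opposite.op a))).1.1) (q : D.obj (Opposite.op c) ⟶ Z),
    (t (D.obj (Opposite.op a))).1.2.1 f ∧
      IsPullback (D.map (homOfLE hbc).op) q
        (D.map (homOfLE hab).op ≫ (t (D.obj (Opposite.op a))).2) f

/-- `D a` is the limit of the restriction of `D` to the elements below `a`. -/
def IsLimitAt {Q : Type u} [Preorder Q] (D : Qᵒᵖ ⥤ C) (a : Q) : Prop :=
  ∀ (A : C) (x : ∀ p, p < a → (A ⟶ D.obj (Opposite.op p))),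
    (∀ p q (hpq : p ≤ q) (hq : q < a),
      x q hq ≫ D.map (homOfLE hpq).op = x p (hpq.trans_lt hq)) →
    ∃! l : A ⟶ D.obj (Opposite.op a), ∀ p (hp : p < a), l ≫ D.map (homOfLE hp.le).op = x p hp

variable {J : Type u} [LinearOrder J]

lemma isLimitAt_restrictLower_iff {s s' : LowerSet J} (h : s ≤ s') (D : (s')ᵒᵖ ⥤ C) (a : J)
    (ha : a ∈ s) :
    IsLimitAt (restrictLower h D) ⟨a, ha⟩ ↔ IsLimitAt D ⟨a, h ha⟩ := by
  constructor
  · intro H A x hx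
    obtain ⟨l, hl, hu⟩ := H A (fun p hp => x ⟨p.1, h p.2⟩ hp) (fun p q hpq hq => hx _ _ hpq hq)
    exact ⟨l, fun p hp => hl ⟨p.1, s.lower (le_of_lt hp) ha⟩ hp,
      fun l' hl' => hu l' fun p hp => hl' _ hp⟩
  · intro H A x hx
    obtain ⟨l, hl, hu⟩ := H A (fun p hp => x ⟨p.1, s.lower (le_of_lt hp) ha⟩ hp)
      (fun p q hpq hq => hx ⟨p.1, s.lower (hpq.trans hq.le) ha⟩ ⟨q.1, s.lower (le_of_lt hq) ha⟩
        hpq hq)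
    exact ⟨l, fun p hp => hl ⟨p.1, h p.2⟩ hp,
      fun l' hl' => hu l' fun p hp => hl' ⟨p.1, s.lower (le_of_lt hp) ha⟩ hp⟩

lemma isLimitAt_coneExtension {Q : Type u} [Preorder Q] {D : Qᵒᵖ ⥤ C} {c : Cone D}
    (hc : IsLimit c) : IsLimitAt (coneExtension D c) ⊤ := by
  intro A x hx
  let y : Cone D :=
    { pt := A
      π :=
        { app p := x (p.unop : WithTop Q) (WithTop.coe_lt_top _)
          naturality p q f := (Category.id_comp _).trans
            (hx _ _ (WithTop.coe_le_coe.2 (leOfHom f.unop)) (WithTop.coe_lt_top p.unop)).symm } }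
  refine ⟨hc.lift y, fun p hp => ?_, fun l hl => ?_⟩
  · obtain ⟨p, rfl⟩ := WithTop.ne_top_iff_exists.1 hp.ne
    exact hc.fac y (Opposite.op p)
  · exact hc.uniq y l fun p => hl (p.unop : WithTop Q) (WithTop.coe_lt_top p.unop)

/-- The map `e` may fail to be injective, but `g` is a section of it below `e a` with `p ≤ g (e p)`,
so a compatible family below `a` is determined by its members at the `g q`. -/
lemma isLimitAt_functor_op_comp {P Q : Type u} [Preorder P] [Preorder Q] {e : P → Q}
    (he : Monotone e) (K : Qᵒᵖ ⥤ C) (a : P) (hlt : ∀ p < a, e p < e a)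
    (g : ∀ q, q < e a → P) (hg : ∀ q hq, e (g q hq) = q) (hga : ∀ q hq, g q hq < a)
    (hgm : ∀ q q' hq hq', q ≤ q' → g q hq ≤ g q' hq') (hge : ∀ p (hp : p < a), p ≤ g _ (hlt p hp))
    (H : IsLimitAt K (e a)) : IsLimitAt (he.functor.op ⋙ K) a := by
  intro A (x : ∀ p, p < a → (A ⟶ K.obj (Opposite.op (e p)))) hx
  replace hx : ∀ p q (hpq : p ≤ q) (hq : q < a),
    x q hq ≫ K.map (homOfLE (he hpq)).op = x p (hpq.trans_lt hq) := hx
  have hcomp : ∀ {q₁ q₂ q₃ : Q} (h₁ : q₁ ≤ q₂) (h₂ : q₂ ≤ q₃),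
      K.map (homOfLE h₂).op ≫ K.map (homOfLE h₁).op = K.map (homOfLE (h₁.trans h₂)).op :=
    fun h₁ h₂ => (K.map_comp (homOfLE h₂).op (homOfLE h₁).op).symm
  obtain ⟨l, hl, hu⟩ := H A (fun q hq => x (g q hq) (hga q hq) ≫ K.map (homOfLE (hg q hq).ge).op)
    (fun q q' hqq hq' => by
      rw [← hx _ _ (hgm q q' (hqq.trans_lt hq') hq' hqq) (hga q' hq'), Category.assoc,
        Category.assoc, hcomp, hcomp])
  refine ⟨l, fun p hp => ?_, fun (l' : A ⟶ K.obj (Opposite.op (e a))) hl' =>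
    hu l' fun q hq => ?_⟩
  · exact (hl (e p) (hlt p hp)).trans (hx _ _ (hge p hp) _)
  · rw [← hl' _ (hga q hq)]
    change _ = (l' ≫ K.map (homOfLE (he (hga q hq).le)).op) ≫ _
    rw [Category.assoc, hcomp]

lemma isLimitAt_extendLower {s s' : LowerSet J} {D : (s)ᵒᵖ ⥤ C} {c : Cone D} (hc : IsLimit c)
    (h : s ≤ s') (a : J) (ha' : a ∈ s') (ha : a ∉ s) (hlt : ∀ b < a, b ∈ s) :
    IsLimitAt (extendLower D c s') ⟨a, ha'⟩ := by
  have hsa : ∀ b ∈ s, b < a := fun b hb => lt_of_not_ge fun hab => ha (s.lower hab hb)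
  have ea : collapse s s' ⟨a, ha'⟩ = ⊤ := collapse_of_notMem _ ha
  have hq : ∀ q, q < collapse s s' ⟨a, ha'⟩ → q ≠ ⊤ := fun q hq => (ea ▸ hq).ne
  refine isLimitAt_functor_op_comp (collapse_mono s s') (coneExtension D c) ⟨a, ha'⟩ ?_
    (fun q h' => ⟨(q.untop (hq q h')).1, h (q.untop (hq q h')).2⟩) ?_ ?_ ?_ ?_
    (ea ▸ isLimitAt_coneExtension hc)
  · intro p hp
    rw [ea, collapse_of_mem p (hlt _ hp)]
    exact WithTop.coe_lt_top _
  · intro q h'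
    exact (collapse_of_mem _ (q.untop (hq q h')).2).trans (WithTop.coe_untop q (hq q h'))
  · intro q h'
    exact hsa _ (q.untop (hq q h')).2
  · intro q q' h₁ h₂ h₃
    exact (WithTop.untop_le_untop_iff (hq q h₁) (hq q' h₂)).2 h₃
  · intro p hp
    refine le_of_eq (Subtype.ext ?_)
    simp [collapse_of_mem p (hlt _ hp)]

/-- A strategy prescribes, at stage `β`, a task for the object of an earlier stage `look β`. -/
structure Strategy (E : Precoverage C) (J : Type u) [LinearOrder J] where
  look : J → J
  look_le : ∀ β, look β ≤ β
  task : ∀ (_ : J) (X : C), Task E X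

variable {E : Precoverage C} [OrderBot J] [SuccOrder J] (σ : Strategy E J)
  (P : MorphismProperty C) (x₀ : C)

/-- A run of the strategy `σ` along a lower set `s` of stages, starting at `x₀`, which must not
continue after a stage where the arrow to the root has the property `P`. -/
structure IsRun (s : LowerSet J) (D : (s)ᵒᵖ ⥤ C) : Prop where
  root : ∀ h : ⊥ ∈ s, D.obj (Opposite.op ⟨⊥, h⟩) = x₀
  step : ∀ β (h : Order.succ β ∈ s), IsStep D (σ.task β)
    (a := ⟨σ.look β, s.lower ((σ.look_le β).trans (Order.le_succ β)) h⟩)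
    (b := ⟨β, s.lower (Order.le_succ β) h⟩) (c := ⟨Order.succ β, h⟩)
    (σ.look_le β) (Order.le_succ β)
  unstopped : ∀ β (h : Order.succ β ∈ s), ¬ P (D.map (homOfLE
    (show (⟨⊥, s.lower bot_le h⟩ : s) ≤ ⟨β, s.lower (Order.le_succ β) h⟩ from
      (bot_le : (⊥ : J) ≤ β))).op)
  limit : ∀ a (h : a ∈ s), Order.IsSuccLimit a → IsLimitAt D ⟨a, h⟩

variable {σ P x₀}

lemma IsRun.restrictLower {s s' : LowerSet J} {D : (s')ᵒᵖ ⥤ C} (hD : IsRun σ P x₀ s' D)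
    (h : s ≤ s') : IsRun σ P x₀ s (restrictLower h D) where
  root hs := hD.root (h hs)
  step β hβ := hD.step β (h hβ)
  unstopped β hβ := hD.unstopped β (h hβ)
  limit a ha hl := (isLimitAt_restrictLower_iff h D a ha).2 (hD.limit a (h ha) hl)

/-- Each clause involves only the stages up to a single one. This is what makes the union of a chain
of runs a run. -/
lemma IsRun.of_forall_Iic {s : LowerSet J} {D : (s)ᵒᵖ ⥤ C}
    (H : ∀ β (h : β ∈ s), IsRun σ P x₀ (LowerSet.Iic β)
      (LexSite.restrictLower (LowerSet.Iic_le.2 h) D)) :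
    IsRun σ P x₀ s D where
  root hs := (H ⊥ hs).root (le_refl (⊥ : J))
  step β hβ := (H _ hβ).step β (le_refl (Order.succ β))
  unstopped β hβ := (H _ hβ).unstopped β (le_refl (Order.succ β))
  limit a ha hl := (isLimitAt_restrictLower_iff (LowerSet.Iic_le.2 ha) D a (le_refl a)).1
    ((H _ ha).limit a (le_refl a) hl)

variable (σ P x₀)

/-- A vertex of the tree of all runs: a run that has a last stage. -/
structure Node where
  ht : J
  D : (LowerSet.Iic ht)ᵒᵖ ⥤ C
  run : IsRun σ P x₀ (LowerSet.Iic ht) D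

namespace Node

variable {σ P x₀}

/-- The initial segment of a run, up to the stage `a`. -/
def trunc (m : Node σ P x₀) (a : J) (h : a ≤ m.ht) : Node σ P x₀ :=
  ⟨a, restrictLower (LowerSet.Iic_le.2 h) m.D, m.run.restrictLower _⟩

lemma trunc_congr {m m' : Node σ P x₀} (e : m = m') (a : J) (h : a ≤ m.ht) (h' : a ≤ m'.ht) :
    m.trunc a h = m'.trunc a h' := by
  subst e
  rfl

lemma trunc_eq_self (m : Node σ P x₀) {a : J} (h : a = m.ht) : m.trunc a h.le = m := by
  subst h
  rfl

lemma mk_eq (m : Node σ P x₀) (D : (LowerSet.Iic m.ht)ᵒᵖ ⥤ C) (hD : IsRun σ P x₀ _ D)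
    (h : D = m.D) : (⟨m.ht, D, hD⟩ : Node σ P x₀) = m := by
  subst h
  rfl

/-- Initial segments are compared by equality of diagrams. The runs below `m` are then exactly its
truncations, which yields antisymmetry and the tree property. -/
instance : PartialOrder (Node σ P x₀) where
  le n m := ∃ h : n.ht ≤ m.ht, m.trunc n.ht h = n
  le_refl n := ⟨le_rfl, rfl⟩
  le_trans n m k := by
    rintro ⟨h, hn⟩ ⟨h', hm⟩
    exact ⟨h.trans h', (trunc_congr hm n.ht h h).trans hn⟩
  le_antisymm n m := by
    rintro ⟨h, hn⟩ ⟨h', hm⟩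
    rw [← hn]
    exact m.trunc_eq_self (le_antisymm h h')

lemma ht_mono {n m : Node σ P x₀} (h : n ≤ m) : n.ht ≤ m.ht := h.1

lemma trunc_le (m : Node σ P x₀) (a : J) (h : a ≤ m.ht) : m.trunc a h ≤ m := ⟨h, rfl⟩

lemma eq_of_le {n m : Node σ P x₀} (h : n ≤ m) (h' : n.ht = m.ht) : n = m :=
  h.2.symm.trans (m.trunc_eq_self h')

lemma ht_strictMono {n m : Node σ P x₀} (h : n < m) : n.ht < m.ht :=
  lt_of_le_of_ne (ht_mono h.le) fun e => h.ne (eq_of_le h.le e)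

lemma le_of_le_of_le {n k m : Node σ P x₀} (hn : n ≤ m) (hk : k ≤ m) (h : n.ht ≤ k.ht) :
    n ≤ k := by
  obtain ⟨h₁, h₂⟩ := hn
  obtain ⟨h₃, h₄⟩ := hk
  exact ⟨h, (trunc_congr h₄.symm n.ht h h).trans h₂⟩

lemma exists_eq_trunc {n m : Node σ P x₀} (h : n ≤ m) : ∃ a ha, n = m.trunc a ha :=
  ⟨_, h.1, h.2.symm⟩

/-- The object at the last stage of a run. -/
abbrev obj (m : Node σ P x₀) : C := m.D.obj (Opposite.op ⟨m.ht, le_refl m.ht⟩)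

/-- The arrow between the last objects of a run and of an initial segment of it. -/
def hom {n m : Node σ P x₀} (h : n ≤ m) : m.obj ⟶ n.obj :=
  m.D.map (homOfLE (show (⟨n.ht, h.1⟩ : LowerSet.Iic m.ht) ≤ ⟨m.ht, le_refl m.ht⟩ from h.1)).op ≫
    eqToHom (congrArg obj h.2)

lemma hom_trunc (m : Node σ P x₀) (a : J) (h : a ≤ m.ht) :
    hom (m.trunc_le a h) = m.D.map
      (homOfLE (show (⟨a, h⟩ : LowerSet.Iic m.ht) ≤ ⟨m.ht, le_refl m.ht⟩ from h)).op :=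
  Category.comp_id _

lemma hom_trunc_trunc (m : Node σ P x₀) (a b : J) (hab : a ≤ b) (hb : b ≤ m.ht)
    (h : m.trunc a (hab.trans hb) ≤ m.trunc b hb) :
    hom h = m.D.map
      (homOfLE (show (⟨a, hab.trans hb⟩ : LowerSet.Iic m.ht) ≤ ⟨b, hb⟩ from hab)).op :=
  hom_trunc (m.trunc b hb) a hab

variable (σ P x₀) in
/-- The diagram of the last objects of runs. -/
def diag : (Node σ P x₀)ᵒᵖ ⥤ C where
  obj m := m.unop.obj
  map {m n} f := hom (leOfHom f.unop)
  map_id m := (hom_trunc m.unop _ le_rfl).trans (m.unop.D.map_id _)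
  map_comp {m n k} f g := by
    obtain ⟨m⟩ := m
    obtain ⟨n⟩ := n
    obtain ⟨k⟩ := k
    obtain ⟨a, ha, rfl⟩ := exists_eq_trunc (leOfHom f.unop)
    obtain ⟨b, hb, rfl⟩ := exists_eq_trunc (leOfHom g.unop)
    have hb' : b ≤ a := hb
    refine (hom_trunc m b (hb'.trans ha)).trans ?_
    have h1 := hom_trunc m a ha
    have h2 := hom_trunc (m.trunc a ha) b hb
    refine Eq.trans ?_ (congrArg₂ (· ≫ ·) h1 h2).symm
    exact m.D.map_comp (homOfLE (show (⟨a, ha⟩ : LowerSet.Iic m.ht) ≤ ⟨m.ht, le_refl m.ht⟩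
      from ha)).op (homOfLE (show (⟨b, hb'.trans ha⟩ : LowerSet.Iic m.ht) ≤ ⟨a, ha⟩ from hb')).op

/-- A run is recovered from the last objects of its initial segments. -/
lemma functor_op_comp_diag (m : Node σ P x₀) (f : LowerSet.Iic m.ht → Node σ P x₀)
    (hf : Monotone f) (h : ∀ a, f a = m.trunc a.1 a.2) :
    hf.functor.op ⋙ diag σ P x₀ = m.D := by
  obtain rfl : f = fun a => m.trunc a.1 a.2 := funext h
  refine CategoryTheory.Functor.ext (fun _ => rfl) fun x y g => ?_
  refine Eq.trans ?_ ((Category.id_comp _).trans (Category.comp_id _)).symm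
  exact hom_trunc_trunc m y.unop.1 x.unop.1 (leOfHom g.unop) x.unop.2
    (hf (leOfHom g.unop))

end Node

end Runs

/-! ### Successors and limits in the tree of runs -/

section Tree

variable {C : Type u} [SmallCategory C]

lemma coneExtension_map_comp_eqToHom {Q : Type u} [Preorder Q] {D : Qᵒᵖ ⥤ C} {c : Cone D}
    {u v : WithTop Q} {p : Q} (hu : u = ⊤) (hv : v = p) (h : v ≤ u)
    (e : (coneExtension D c).obj (Opposite.op v) = D.obj (Opposite.op p))
    (e' : (coneExtension D c).obj (Opposite.op u) = c.pt) :
    (coneExtension D c).map (homOfLE h).op ≫ eqToHom e =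
      eqToHom e' ≫ c.π.app (Opposite.op p) := by
  subst hu hv
  exact (Category.comp_id _).trans (Category.id_comp _).symm

lemma IsStep.congr {E : Precoverage C} {Q : Type u} [Preorder Q] {D : Qᵒᵖ ⥤ C}
    {t : ∀ X, Task E X} {a b c a' b' c' : Q} {hab : a ≤ b} {hbc : b ≤ c} (H : IsStep D t hab hbc)
    (ha : a' = a) (hb : b' = b) (hc : c' = c) (hab' : a' ≤ b') (hbc' : b' ≤ c') :
    IsStep D t hab' hbc' := by
  subst ha hb hc
  exact H

lemma map_homOfLE_congr (P : MorphismProperty C) {Q : Type u} [Preorder Q] {D : Qᵒᵖ ⥤ C}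
    {a b a' b' : Q} (ha : a' = a) (hb : b' = b) (hab : a ≤ b) (hab' : a' ≤ b') :
    P (D.map (homOfLE hab').op) ↔ P (D.map (homOfLE hab).op) := by
  subst ha hb
  rfl

variable {J : Type u} [LinearOrder J] {E : Precoverage C} [OrderBot J] [SuccOrder J]
  {σ : Strategy E J} {P : MorphismProperty C} {x₀ : C}

lemma IsRun.of_restrictLower {s s' : LowerSet J} (h : s ≤ s') {D : (s')ᵒᵖ ⥤ C} (hs : ⊥ ∈ s)
    (hD : IsRun σ P x₀ s (LexSite.restrictLower h D))
    (step : ∀ β (h : Order.succ β ∈ s'), Order.succ β ∉ s → IsStep D (σ.task β)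
      (a := ⟨σ.look β, s'.lower ((σ.look_le β).trans (Order.le_succ β)) h⟩)
      (b := ⟨β, s'.lower (Order.le_succ β) h⟩) (c := ⟨Order.succ β, h⟩)
      (σ.look_le β) (Order.le_succ β))
    (unstopped : ∀ β (h : Order.succ β ∈ s'), Order.succ β ∉ s → ¬ P (D.map (homOfLE
      (show (⟨⊥, s'.lower bot_le h⟩ : s') ≤ ⟨β, s'.lower (Order.le_succ β) h⟩ from
        (bot_le : (⊥ : J) ≤ β))).op))
    (limit : ∀ a (h : a ∈ s'), a ∉ s → Order.IsSuccLimit a → IsLimitAt D ⟨a, h⟩) :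
    IsRun σ P x₀ s' D where
  root _ := hD.root hs
  step β hβ := by
    by_cases hs : Order.succ β ∈ s
    · exact hD.step β hs
    · exact step β hβ hs
  unstopped β hβ := by
    by_cases hs : Order.succ β ∈ s
    · exact hD.unstopped β hs
    · exact unstopped β hβ hs
  limit a ha hl := by
    by_cases hs : a ∈ s
    · exact (isLimitAt_restrictLower_iff h D a hs).1 (hD.limit a hs hl)
    · exact limit a ha hs hl

namespace Node

/-- The run has reached a stage where the arrow to the root has the property `P`. -/
def Stops (m : Node σ P x₀) : Prop :=
  P (m.D.map (homOfLE (show (⟨⊥, (bot_le : (⊥ : J) ≤ m.ht)⟩ : LowerSet.Iic m.ht) ≤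
    ⟨m.ht, le_refl m.ht⟩ from (bot_le : (⊥ : J) ≤ m.ht))).op)

/-- A proper extension contains the stage after `m.ht`, which `unstopped` forbids if `m` stops. Thus
stopping vertices are maximal. -/
lemma not_stops_of_lt {m n : Node σ P x₀} (h : m < n) : ¬ m.Stops := by
  have := n.run.unstopped m.ht (Order.succ_le_of_lt (ht_strictMono h))
  have hm := h.le.2
  rw [← hm]
  exact this

lemma isChain_Iic (t : Node σ P x₀) : IsChain (· ≤ ·) (Set.Iic t) := by
  intro n hn k hk _
  rcases le_total n.ht k.ht with h | h
  · exact Or.inl (le_of_le_of_le hn hk h)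
  · exact Or.inr (le_of_le_of_le hk hn h)

variable [NoMaxOrder J]

instance : OrderBot (Node σ P x₀) where
  bot :=
    { ht := ⊥
      D := (Functor.const _).obj x₀
      run :=
        { root := fun _ => rfl
          step := fun β h => absurd (Order.lt_succ β) (not_lt_of_ge (le_trans h bot_le))
          unstopped := fun β h => absurd (Order.lt_succ β) (not_lt_of_ge (le_trans h bot_le))
          limit := fun a h hl => absurd (isMin_iff_eq_bot.2 (le_bot_iff.1 h)) hl.not_isMin } }
  bot_le m := by
    refine ⟨bot_le, mk_eq _ _ _ ?_⟩
    have hx : ∀ x : (LowerSet.Iic (⊥ : J))ᵒᵖ,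
        x = Opposite.op ⟨⊥, le_refl (⊥ : J)⟩ := fun x =>
      congrArg Opposite.op (Subtype.ext (le_bot_iff.1 x.unop.2))
    refine CategoryTheory.Functor.ext (fun x => ?_) (fun x y f => ?_)
    · rw [hx x]
      exact m.run.root _
    · obtain rfl := hx x
      obtain rfl := hx y
      obtain rfl : f = 𝟙 _ := Subsingleton.elim _ _
      simp

lemma covBy_iff {m n : Node σ P x₀} : m ⋖ n ↔ m ≤ n ∧ n.ht = Order.succ m.ht := by
  constructor
  · intro h
    refine ⟨h.le, ?_⟩
    have h' : Order.succ m.ht ≤ n.ht := Order.succ_le_of_lt (ht_strictMono h.lt)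
    by_contra hne
    have hlt : n.trunc _ h' < n := lt_of_le_of_ne (n.trunc_le _ h') fun e =>
      hne (congrArg ht e).symm
    refine h.2 (lt_of_le_of_ne (le_of_le_of_le h.le (n.trunc_le _ h') (Order.le_succ m.ht)) ?_) hlt
    intro e
    exact (Order.lt_succ m.ht).ne (congrArg ht e)
  · rintro ⟨h, e⟩
    refine ⟨lt_of_le_of_ne h fun h' => ?_, fun k h₁ h₂ => ?_⟩
    · rw [← h'] at e
      exact (Order.lt_succ m.ht).ne e
    · have h₃ := ht_strictMono h₂
      rw [e, Order.lt_succ_iff] at h₃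
      exact not_lt_of_ge h₃ (ht_strictMono h₁)

lemma isSuccLimit_ht {t : Node σ P x₀} (ht : Order.IsSuccLimit t) : Order.IsSuccLimit t.ht := by
  constructor
  · intro h
    refine ht.1 ?_
    have : t = ⊥ := (eq_of_le bot_le (isMin_iff_eq_bot.1 h).symm).symm
    rw [this]
    exact isMin_bot
  · intro b hb
    exact ht.2 (t.trunc b hb.le) (covBy_iff.2 ⟨t.trunc_le b hb.le, (Order.succ_eq_of_covBy hb).symm⟩)

/-- The vertices below `t` are its truncations, so a cone over them is a compatible family as in the
`limit` clause for `t`. -/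
lemma nonempty_isLimit {t : Node σ P x₀} (ht : Order.IsSuccLimit t) :
    Nonempty (IsLimit (coneOfUpperBound (diag σ P x₀) (Set.Iio t) t (fun _ hs => le_of_lt hs))) := by
  have H := t.run.limit t.ht (le_refl t.ht) (isSuccLimit_ht ht)
  have hlt : ∀ p : LowerSet.Iic t.ht, p < ⟨t.ht, le_refl t.ht⟩ → t.trunc p.1 p.2 < t :=
    fun p hp => lt_of_le_of_ne (t.trunc_le _ _) fun e => (ne_of_lt hp) (Subtype.ext (congrArg Node.ht e))
  refine ⟨IsLimit.ofExistsUnique fun s => ?_⟩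
  obtain ⟨l, hl, hu⟩ := H s.pt (fun p hp => s.π.app (Opposite.op ⟨t.trunc p.1 p.2, hlt p hp⟩))
    (fun p q hpq hq => by
      have hle : t.trunc p.1 p.2 ≤ t.trunc q.1 q.2 :=
        le_of_le_of_le (t.trunc_le _ _) (t.trunc_le _ _) hpq
      have h1 := s.w (j := Opposite.op ⟨t.trunc q.1 q.2, hlt q hq⟩)
        (j' := Opposite.op ⟨t.trunc p.1 p.2, hlt p (hpq.trans_lt hq)⟩) (homOfLE hle).op
      refine Eq.trans ?_ h1
      exact congrArg (_ ≫ ·) (hom_trunc_trunc t p.1 q.1 hpq q.2 hle).symm)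
  refine ⟨l, fun n => ?_, fun l' hl' => hu l' fun p hp => ?_⟩
  · obtain ⟨⟨n, hn⟩⟩ := n
    obtain ⟨a, ha, rfl⟩ := exists_eq_trunc (le_of_lt hn)
    refine Eq.trans ?_ (hl ⟨a, ha⟩ (ht_strictMono hn))
    exact congrArg (_ ≫ ·) (hom_trunc t a ha)
  · refine Eq.trans ?_ (hl' (Opposite.op ⟨t.trunc p.1 p.2, hlt p hp⟩))
    exact congrArg (_ ≫ ·) (hom_trunc t p.1 p.2).symm

/-- The task of the strategy for the last stage of a run. -/
def lastTask (m : Node σ P x₀) : Task E m.obj :=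
  let t := σ.task m.ht (m.D.obj (Opposite.op ⟨σ.look m.ht, σ.look_le m.ht⟩))
  ⟨t.1, m.D.map (homOfLE (show (⟨σ.look m.ht, σ.look_le m.ht⟩ : LowerSet.Iic m.ht) ≤
    ⟨m.ht, le_refl m.ht⟩ from σ.look_le m.ht)).op ≫ t.2⟩

lemma exists_isPullback_of_covBy {m n : Node σ P x₀} (h : m ⋖ n) :
    ∃ (Z : C) (f : Z ⟶ m.lastTask.1.1) (q : n.obj ⟶ Z), m.lastTask.1.2.1 f ∧
      IsPullback (hom h.le) q m.lastTask.2 f := by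
  obtain ⟨hle, hht⟩ := covBy_iff.1 h
  obtain ⟨a, ha, rfl⟩ := exists_eq_trunc hle
  obtain ⟨b, D, hD⟩ := n
  obtain rfl : b = Order.succ a := hht
  obtain ⟨Z, f, q, hf, hq⟩ := hD.step a (le_refl (Order.succ a))
  refine ⟨Z, f, q, hf, ?_⟩
  have := hom_trunc (⟨_, D, hD⟩ : Node σ P x₀) a ha
  rw [this]
  exact hq

/-- Any pullback may serve as the next object: it is placed on top of `m.D`, with `p` followed by
the arrows of `m.D` as cone. -/
lemma exists_covBy_isPullback (m : Node σ P x₀) (hm : ¬ m.Stops) {W Z : C}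
    {f : Z ⟶ m.lastTask.1.1} (hf : m.lastTask.1.2.1 f) {p : W ⟶ m.obj} {q : W ⟶ Z}
    (hp : IsPullback p q m.lastTask.2 f) :
    ∃ (n : Node σ P x₀) (h : m ⋖ n) (q' : n.obj ⟶ Z),
      IsPullback (hom h.le) q' m.lastTask.2 f := by
  let c : Cone m.D :=
    { pt := W
      π :=
        { app x := p ≫ m.D.map (homOfLE (show x.unop ≤ ⟨m.ht, le_refl m.ht⟩ from x.unop.2)).op
          naturality x y g := by
            refine (Category.id_comp _).trans (Eq.trans ?_ (Category.assoc _ _ _).symm)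
            exact congrArg (p ≫ ·) (m.D.map_comp _ g) } }
  have hcp : c.π.app (Opposite.op ⟨m.ht, le_refl m.ht⟩) = p :=
    (congrArg (p ≫ ·) (m.D.map_id _)).trans (Category.comp_id p)
  have hs : LowerSet.Iic m.ht ≤ LowerSet.Iic (Order.succ m.ht) :=
    LowerSet.Iic_le.2 (Order.le_succ m.ht)
  let N := extendLower m.D c (LowerSet.Iic (Order.succ m.ht))
  have hN : restrictLower hs N = m.D := restrictLower_extendLower hs m.D c
  have hlast : ∀ β, Order.succ β ∈ LowerSet.Iic (Order.succ m.ht) →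
      Order.succ β ∉ LowerSet.Iic m.ht → β = m.ht := by
    intro β h₁ h₂
    refine le_antisymm (Order.succ_le_succ_iff.1 h₁) ?_
    exact Order.lt_succ_iff.1 (lt_of_not_ge h₂)
  have hcm : ∀ (a : J) (ha : a ≤ m.ht) (ha'), collapse (LowerSet.Iic m.ht)
      (LowerSet.Iic (Order.succ m.ht)) ⟨a, ha'⟩ = ((⟨a, ha⟩ : LowerSet.Iic m.ht) : WithTop _) :=
    fun a ha ha' => collapse_of_mem _ ha
  have hct : ∀ ha', collapse (LowerSet.Iic m.ht)
      (LowerSet.Iic (Order.succ m.ht)) ⟨Order.succ m.ht, ha'⟩ = ⊤ :=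
    fun ha' => collapse_of_notMem _ (not_le_of_gt (Order.lt_succ m.ht))
  have hrun : IsRun σ P x₀ (LowerSet.Iic (Order.succ m.ht)) N := by
    refine IsRun.of_restrictLower hs (bot_le : (⊥ : J) ≤ m.ht) ?_ ?_ ?_ ?_
    · rw [hN]
      exact m.run
    · intro β h₁ h₂
      obtain rfl := hlast β h₁ h₂
      refine IsStep.congr (D := coneExtension m.D c)
        (a := ((⟨σ.look m.ht, σ.look_le m.ht⟩ : LowerSet.Iic m.ht) : WithTop _))
        (b := ((⟨m.ht, le_refl m.ht⟩ : LowerSet.Iic m.ht) : WithTop _)) (c := ⊤)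
        (hab := WithTop.coe_le_coe.2 (Subtype.mk_le_mk.2 (σ.look_le m.ht))) (hbc := le_top) ?_
        (hcm _ (σ.look_le m.ht) _) (hcm _ le_rfl _) (hct _) _ _
      refine ⟨Z, f, q, hf, ?_⟩
      have h3 : (coneExtension m.D c).map (homOfLE (le_top :
        ((⟨m.ht, le_refl m.ht⟩ : LowerSet.Iic m.ht) : WithTop (LowerSet.Iic m.ht)) ≤ ⊤)).op = p := hcp
      rw [h3]
      exact hp
    · intro β h₁ h₂
      obtain rfl := hlast β h₁ h₂
      intro h
      refine hm ?_
      exact (map_homOfLE_congr P (D := coneExtension m.D c)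
        (a := ((⟨⊥, (bot_le : (⊥ : J) ≤ m.ht)⟩ : LowerSet.Iic m.ht) : WithTop _))
        (b := ((⟨m.ht, le_refl m.ht⟩ : LowerSet.Iic m.ht) : WithTop _))
        (hcm _ bot_le _) (hcm _ le_rfl _)
        (WithTop.coe_le_coe.2 (Subtype.mk_le_mk.2 (bot_le : (⊥ : J) ≤ m.ht))) _).1 h
    · intro a h₁ h₂ hl
      have : a = Order.succ m.ht := le_antisymm h₁ (Order.succ_le_of_lt (lt_of_not_ge h₂))
      subst this
      exact absurd hl (Order.not_isSuccLimit_succ m.ht)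
  let n : Node σ P x₀ := ⟨Order.succ m.ht, N, hrun⟩
  have hmn : m ⋖ n := covBy_iff.2 ⟨⟨Order.le_succ m.ht, m.mk_eq _ _ hN⟩, rfl⟩
  refine ⟨n, hmn, ?_⟩
  have e' : n.obj = W := congrArg (fun u => (coneExtension m.D c).obj (Opposite.op u)) (hct (le_refl _))
  have hh : hom hmn.le = eqToHom e' ≫ p := by
    refine Eq.trans ?_ (congrArg (eqToHom e' ≫ ·) hcp)
    exact coneExtension_map_comp_eqToHom (hct _) (hcm _ le_rfl _)
      (collapse_mono _ _ (Order.le_succ m.ht)) _ e'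
  -- The object `n.obj` equals `W` only propositionally, so the square is transported along
  -- `eqToHom`.
  have key : ∀ {W' : C} (e : W' = W), IsPullback (eqToHom e ≫ p) (eqToHom e ≫ q) m.lastTask.2 f := by
    rintro _ rfl
    simpa using hp
  refine ⟨eqToHom e' ≫ q, ?_⟩
  rw [hh]
  exact key e'

/-- The successors realise every pullback of every member of the task's family up to isomorphism, so
no pullbacks are chosen. If that family is empty, `m` is maximal without being a leaf. -/
lemma children_mem [HasPullbacks C] (m : Node σ P x₀) (hm : ¬ m.Stops) :
    Presieve.ofArrows (fun s : {s : Node σ P x₀ // m ⋖ s} => (diag σ P x₀).obj (Opposite.op s.1))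
      (fun s => (diag σ P x₀).map (homOfLE s.2.le).op) ∈
        pullbackClosure E ((diag σ P x₀).obj (Opposite.op m)) := by
  refine ⟨m.lastTask.1.1, m.lastTask.2, m.lastTask.1.2.1, m.lastTask.1.2.2, ?_, ?_⟩
  · rintro W _ ⟨⟨n, hn⟩⟩
    exact exists_isPullback_of_covBy hn
  · intro Z f hf
    obtain ⟨n, hn, q, hq⟩ := m.exists_covBy_isPullback hm hf (IsPullback.of_hasPullback _ f)
    exact ⟨_, _, q, Presieve.ofArrows.mk (⟨n, hn⟩ : {s : Node σ P x₀ // m ⋖ s}), hq⟩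

end Node

end Tree

/-! ### The cotree of runs and the covering sieve -/

section Cotree

variable {C : Type u} [SmallCategory C] {J : Type u} [LinearOrder J] {E : Precoverage C}
  [OrderBot J] [SuccOrder J] {σ : Strategy E J} {P : MorphismProperty C} {x₀ : C}

namespace Node

lemma le_of_mem_flag (b : Flag (Node σ P x₀)) {n m : Node σ P x₀} (hn : n ∈ b) (hm : m ∈ b)
    (h : n.ht ≤ m.ht) : n ≤ m := by
  rcases b.le_or_le hn hm with h' | h'
  · exact h'
  · exact (eq_of_le h' (le_antisymm (ht_mono h') h)).ge

lemma mem_flag_of_le (b : Flag (Node σ P x₀)) {n m : Node σ P x₀} (h : n ≤ m) (hm : m ∈ b) :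
    n ∈ b := by
  refine Flag.mem_iff_forall_le_or_ge.2 fun k hk => ?_
  rcases b.le_or_le hk hm with h' | h'
  · rcases le_total n.ht k.ht with h'' | h''
    · exact Or.inl (le_of_le_of_le h h' h'')
    · exact Or.inr (le_of_le_of_le h' h h'')
  · exact Or.inl (h.trans h')

variable [NoMaxOrder J]

/-- If no run goes through all stages, then each branch of the tree of runs has a last vertex. -/
lemma exists_greatest_mem_flag [WellFoundedLT J]
    (hno : ∀ D : ((⊤ : LowerSet J))ᵒᵖ ⥤ C, ¬ IsRun σ P x₀ ⊤ D)
    (hlim : ∀ a : J, HasLimitsOfShape ((LowerSet.Iio a : LowerSet J))ᵒᵖ C)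
    (b : Flag (Node σ P x₀)) : ∃ m ∈ b, ∀ n ∈ b, n ≤ m := by
  let s : LowerSet J :=
    { carrier := {γ | ∃ n ∈ b, n.ht = γ}
      lower' := by
        rintro γ δ hδ ⟨n, hn, rfl⟩
        exact ⟨n.trunc δ hδ, mem_flag_of_le b (n.trunc_le δ hδ) hn, rfl⟩ }
  have hs : ∀ γ : s, ∃ n ∈ b, n.ht = γ.1 := fun γ => γ.2
  choose N hNb hN using hs
  have hNmono : Monotone N := fun γ δ h => le_of_mem_flag b (hNb γ) (hNb δ) (by rwa [hN, hN])
  -- The union of the runs in the branch, defined on all stages that the branch reaches.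
  let G : (s)ᵒᵖ ⥤ C := hNmono.functor.op ⋙ diag σ P x₀
  have hG : ∀ (m : Node σ P x₀) (hm : m ∈ b),
      restrictLower (LowerSet.Iic_le.2 (show m.ht ∈ s from ⟨m, hm, rfl⟩)) G = m.D := by
    intro m hm
    refine functor_op_comp_diag m (fun a => N ⟨a.1, s.lower a.2 ⟨m, hm, rfl⟩⟩)
      (fun a a' h => hNmono h) fun a => ?_
    have h1 : N ⟨a.1, s.lower a.2 ⟨m, hm, rfl⟩⟩ ≤ m :=
      le_of_mem_flag b (hNb _) hm ((hN _).trans_le a.2)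
    exact eq_of_le (le_of_le_of_le h1 (m.trunc_le _ _) (hN _).le) (hN _)
  have hrun : IsRun σ P x₀ s G := by
    refine IsRun.of_forall_Iic fun β hβ => ?_
    obtain ⟨m, hm, rfl⟩ := hβ
    rw [hG m hm]
    exact m.run
  have hproper : ∃ a, a ∉ s := by
    by_contra! h
    have hs : ⊤ ≤ s := fun a _ => h a
    exact hno (restrictLower hs G) (hrun.restrictLower hs)
  obtain ⟨a, ha, hmin⟩ := WellFounded.has_min (wellFounded_lt (α := J)) {a | a ∉ s} hproper
  replace hmin : ∀ γ < a, γ ∈ s := fun γ hγ => by_contra fun h => hmin γ h hγ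
  have hlt : ∀ γ ∈ s, γ < a := fun γ hγ => lt_of_not_ge fun h => ha (s.lower h hγ)
  have hbot : ⊥ ∈ s := ⟨⊥, b.bot_mem, rfl⟩
  -- Let `a` be the first stage not reached. If it is a limit, adding the limit of `G` gives a run
  -- above the whole branch, which belongs to it by maximality: a contradiction. Otherwise `a`
  -- covers some `β`, and the run of height `β` is the last vertex.
  by_cases hl : Order.IsSuccLimit a
  · exfalso
    have hsa : s = LowerSet.Iio a := LowerSet.ext (Set.ext fun γ => ⟨hlt γ, hmin γ⟩)
    have : HasLimitsOfShape (s)ᵒᵖ C := by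
      rw [hsa]
      exact hlim a
    have hle : s ≤ LowerSet.Iic a := fun γ hγ => (hlt γ hγ).le
    have hlast : ∀ γ ∈ LowerSet.Iic a, γ ∉ s → γ = a := fun γ h₁ h₂ =>
      le_antisymm h₁ (le_of_not_gt fun h => h₂ (hmin γ h))
    let H := extendLower G (limit.cone G) (LowerSet.Iic a)
    have hH : restrictLower hle H = G := restrictLower_extendLower hle G _
    have hrunH : IsRun σ P x₀ (LowerSet.Iic a) H := by
      refine IsRun.of_restrictLower hle hbot (by rwa [hH]) ?_ ?_ ?_
      · intro β h₁ h₂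
        rw [← hlast _ h₁ h₂] at hl
        exact absurd hl (Order.not_isSuccLimit_succ β)
      · intro β h₁ h₂
        rw [← hlast _ h₁ h₂] at hl
        exact absurd hl (Order.not_isSuccLimit_succ β)
      · intro γ h₁ h₂ _
        obtain rfl := hlast γ h₁ h₂
        exact isLimitAt_extendLower (limit.isLimit G) hle γ h₁ h₂ hmin
    let m : Node σ P x₀ := ⟨a, H, hrunH⟩
    have hm : ∀ n ∈ b, n ≤ m := fun n hn => by
      refine ⟨(hlt _ ⟨n, hn, rfl⟩).le, n.mk_eq _ _ ?_⟩
      rw [← hG n hn, ← hH]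
      rfl
    exact ha ⟨m, Flag.mem_iff_forall_le_or_ge.2 fun n hn => Or.inr (hm n hn), rfl⟩
  · have hnp : ¬ Order.IsSuccPrelimit a := fun h =>
      hl ⟨fun hmin' => ha (isMin_iff_eq_bot.1 hmin' ▸ hbot), h⟩
    obtain ⟨β, hβ⟩ := Order.not_isSuccPrelimit_iff.1 hnp
    obtain ⟨m, hm, hmβ⟩ := hmin β hβ.lt
    refine ⟨m, hm, fun n hn => le_of_mem_flag b hn hm ?_⟩
    rw [hmβ]
    exact hβ.le_of_lt (hlt _ ⟨n, hn, rfl⟩)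

variable (σ P x₀) in
/-- If no run goes through all stages, then the runs form a continuous cotree. -/
def cotree [WellFoundedLT J] [HasPullbacks C] (κ : Cardinal.{u})
    (hJ : ∀ a : J, Cardinal.mk (Set.Iic a) < κ)
    (hno : ∀ D : ((⊤ : LowerSet J))ᵒᵖ ⥤ C, ¬ IsRun σ P x₀ ⊤ D)
    (hlim : ∀ a : J, HasLimitsOfShape ((LowerSet.Iio a : LowerSet J))ᵒᵖ C) :
    ContinuousCotree (pullbackClosure E) κ where
  T := Node σ P x₀
  isChain_Iic := isChain_Iic
  wellFounded := StrictMono.wellFoundedLT (f := ht) fun _ _ => ht_strictMono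
  diag := diag σ P x₀
  leaf := {m | m.Stops}
  isMax_of_leaf m hm := fun n hn => by
    by_contra h
    exact not_stops_of_lt (lt_of_le_not_ge hn h) hm
  children_mem m hm := m.children_mem hm
  branch_lt b := by
    obtain ⟨m, hm, hmax⟩ := exists_greatest_mem_flag hno hlim b
    -- Heights embed the branch into the stages up to that of its last vertex.
    refine lt_of_le_of_lt (Cardinal.mk_le_of_injective
      (f := fun n : (b : Set (Node σ P x₀)) => (⟨n.1.ht, ht_mono (hmax n.1 n.2)⟩ : Set.Iic m.ht))
      fun n k h => Subtype.ext ?_) (hJ m.ht)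
    have h' : n.1.ht = k.1.ht := congrArg Subtype.val h
    exact eq_of_le (le_of_mem_flag b n.2 k.2 h'.le) h'
  continuous _ ht := nonempty_isLimit ht

end Node

lemma IsLexCategory.hasLimitsOfShape_op {κ : Cardinal.{u}} (hC : IsLexCategory κ C)
    (hκ : Cardinal.aleph0 ≤ κ) {Q : Type u} [Preorder Q] (hQ : Cardinal.mk Q < κ) :
    HasLimitsOfShape Qᵒᵖ C := by
  refine hC Qᵒᵖ ?_
  rw [hasCardinalLT_arrow_op_iff, hasCardinalLT_iff_cardinal_mk_lt]
  refine lt_of_le_of_lt (Cardinal.mk_le_of_injective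
    (f := fun g : Arrow Q => (g.left, g.right)) fun g g' h => ?_)
    ((Cardinal.mk_prod Q Q).trans_lt (by
      simpa using Cardinal.mul_lt_of_lt hκ hQ hQ))
  exact Arrow.ext (congrArg Prod.fst h) (congrArg Prod.snd h) (Subsingleton.elim _ _)

lemma IsLexCategory.hasPullbacks {κ : Cardinal.{u}} (hC : IsLexCategory κ C)
    (hκ : Cardinal.aleph0 ≤ κ) : HasPullbacks C := by
  have : HasLimitsOfShape (ULiftHom.{u} (ULift.{u} WalkingCospan)) C :=
    hC _ (hasCardinalLT_of_finite _ _ hκ)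
  exact hasLimitsOfShape_of_equivalence (ULiftHomULiftCategory.equiv.{u, u} WalkingCospan).symm

/-- The arrows in a sieve on `x₀`, as a property of all arrows. -/
def sieveProperty (S : Sieve x₀) : MorphismProperty C :=
  fun _ B p => ∃ h : B = x₀, S (p ≫ eqToHom h)

/-- If every run of the strategy `σ` that starts at `x₀` reaches the sieve `S` before it has gone
through all stages, then `S` is a covering sieve. -/
lemma mem_topology_of_forall_not_isRun [NoMaxOrder J] [WellFoundedLT J] {κ : Cardinal.{u}}
    (hC : IsLexCategory κ C) (hκ : Cardinal.aleph0 ≤ κ)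
    (hJ : ∀ a : J, Cardinal.mk (Set.Iic a) < κ) (S : Sieve x₀)
    (hno : ∀ D : ((⊤ : LowerSet J))ᵒᵖ ⥤ C,
      ¬ IsRun σ (sieveProperty S) x₀ ⊤ D) :
    S ∈ topology κ E x₀ := by
  have := hC.hasPullbacks hκ
  have hlim : ∀ a : J, HasLimitsOfShape ((LowerSet.Iio a : LowerSet J))ᵒᵖ C := fun a =>
    hC.hasLimitsOfShape_op hκ ((Cardinal.mk_le_mk_of_subset
      (fun x (hx : x < a) => hx.le)).trans_lt (hJ a))
  let t := Node.cotree σ (sieveProperty S) x₀ κ hJ hno hlim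
  have ht : ∀ b : t.Branch, HasLimitsOfShape ((b.1 : Set t.T))ᵒᵖ C := fun b =>
    hC.hasLimitsOfShape_op hκ (t.branch_lt b.1)
  let c : ∀ b : t.Branch, LimitCone (t.branchDiagram b) := fun b => getLimitCone _
  refine (topology κ E).superset_covering ?_
    (Precoverage.generate_mem_toGrothendieck (show _ ∈ closure κ E x₀ from IsCotreeFamily.mk t c))
  rintro _ _ ⟨_, g, _, ⟨b⟩, rfl⟩
  obtain ⟨m, hm, hmax⟩ := Node.exists_greatest_mem_flag hno hlim b.1
  -- The last vertex of a branch is maximal in the tree. Dead ends at empty families are excluded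
  -- from `Branch`, so `m` is a leaf and its arrow to the root lies in `S`.
  have hmleaf : m ∈ t.leaf := b.2 m hm fun n hn => by
    refine hmax n (Flag.mem_iff_forall_le_or_ge.2 fun k hk => Or.inr ((hmax k hk).trans hn))
  obtain ⟨h, hS⟩ := hmleaf
  have h1 : t.leg b (c b) = (c b).cone.π.app (Opposite.op ⟨m, hm⟩) ≫
      Node.hom (bot_le : ⊥ ≤ m) :=
    ((c b).cone.w (j := Opposite.op ⟨m, hm⟩) (j' := Opposite.op ⟨⊥, b.1.bot_mem⟩)
      (homOfLE (show (⟨⊥, b.1.bot_mem⟩ : (b.1 : Set t.T)) ≤ ⟨m, hm⟩ from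
        (bot_le : (⊥ : t.T) ≤ m))).op).symm
  refine S.downward_closed ?_ g
  rw [h1]
  exact S.downward_closed hS _

end Cotree

/-! ### The model given by an inverse system -/

section ColimitModel

variable {C : Type u} [SmallCategory C] {I : Type u} [LinearOrder I] (G : Iᵒᵖ ⥤ C)

/-- The arrow of an inverse system for two comparable indices. -/
abbrev transition {i j : I} (h : i ≤ j) : G.obj (Opposite.op j) ⟶ G.obj (Opposite.op i) :=
  G.map (homOfLE h).op

lemma transition_comp {i j k : I} (h : i ≤ j) (h' : j ≤ k) :
    transition G h' ≫ transition G h = transition G (h.trans h') :=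
  (G.map_comp (homOfLE h').op (homOfLE h).op).symm

/-- Two arrows from the inverse system `G` to `X` agree eventually. -/
def eventualEqSetoid (X : C) : Setoid (Σ i : I, (G.obj (Opposite.op i) ⟶ X)) where
  r a b := ∃ (k : I) (ha : a.1 ≤ k) (hb : b.1 ≤ k),
    transition G ha ≫ a.2 = transition G hb ≫ b.2
  iseqv :=
    { refl := fun a => ⟨a.1, le_rfl, le_rfl, rfl⟩
      symm := fun ⟨k, ha, hb, h⟩ => ⟨k, hb, ha, h.symm⟩
      trans := fun ⟨k, ha, hb, h⟩ ⟨l, hb', hc, h'⟩ =>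
        ⟨max k l, ha.trans (le_max_left k l), hc.trans (le_max_right k l), by
          rw [← transition_comp G ha (le_max_left k l), ← transition_comp G hc (le_max_right k l),
            Category.assoc, Category.assoc, h, ← h', ← Category.assoc, ← Category.assoc,
            transition_comp, transition_comp]⟩ }

/-- The colimit of the functors corepresented by the objects of an inverse system. -/
def colimitModel : C ⥤ Type u where
  obj X := Quotient (eventualEqSetoid G X)
  map {X Y} f := TypeCat.ofHom (Quotient.map (fun a => ⟨a.1, a.2 ≫ f⟩) (by
    rintro ⟨i, a⟩ ⟨j, b⟩ ⟨k, ha, hb, h⟩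
    refine ⟨k, ha, hb, ?_⟩
    rw [← Category.assoc, ← Category.assoc]
    exact congrArg (· ≫ f) h))
  map_id X := by
    ext x
    induction x using Quotient.inductionOn with
    | h a => exact congrArg (Quotient.mk _) (congrArg (Sigma.mk a.1) (Category.comp_id _))
  map_comp f g := by
    ext x
    induction x using Quotient.inductionOn with
    | h a =>
      exact congrArg (Quotient.mk _) (congrArg (Sigma.mk a.1) (Category.assoc a.2 f g).symm)

/-- The element of the colimit that is represented by an arrow. -/
def colimitModel.mk {X : C} {i : I} (a : G.obj (Opposite.op i) ⟶ X) : (colimitModel G).obj X :=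
  Quotient.mk (eventualEqSetoid G X) ⟨i, a⟩

namespace colimitModel

variable {G}

lemma exists_rep {X : C} (x : (colimitModel G).obj X) :
    ∃ (i : I) (a : G.obj (Opposite.op i) ⟶ X), mk G a = x := by
  obtain ⟨⟨i, a⟩, h⟩ := Quotient.exists_rep x
  exact ⟨i, a, h⟩

lemma mk_eq_iff {X : C} {i j : I} {a : G.obj (Opposite.op i) ⟶ X}
    {b : G.obj (Opposite.op j) ⟶ X} :
    mk G a = mk G b ↔ ∃ (k : I) (ha : i ≤ k) (hb : j ≤ k),
      transition G ha ≫ a = transition G hb ≫ b :=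
  ⟨fun h => Quotient.exact h, fun h => Quotient.sound h⟩

lemma map_mk {X Y : C} (f : X ⟶ Y) {i : I} (a : G.obj (Opposite.op i) ⟶ X) :
    (colimitModel G).map f (mk G a) = mk G (a ≫ f) := rfl

lemma mk_transition_comp {X : C} {i j : I} (h : i ≤ j) (a : G.obj (Opposite.op i) ⟶ X) :
    mk G (transition G h ≫ a) = mk G a :=
  mk_eq_iff.2 ⟨j, le_rfl, h, by rw [← Category.assoc, transition_comp]⟩

-- This is the commutation of `< κ`-limits with `κ`-directed colimits of sets: fewer than `κ`
-- representatives, and fewer than `κ` equations between them, live at one common stage, where the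
-- universal property in `C` applies.
variable (G) in
lemma isLexFunctor {κ : Cardinal.{u}} (hκ : Cardinal.aleph0 ≤ κ)
    (hI : ∀ (K : Type u) (s : K → I), Cardinal.mk K < κ → ∃ j, ∀ k, s k ≤ j) :
    IsLexFunctor κ (colimitModel G) := by
  intro Q _ hQ
  have hQ₁ : Cardinal.mk (Arrow Q) < κ := (hasCardinalLT_iff_cardinal_mk_lt _ _).1 hQ
  have hQ₀ : Cardinal.mk Q < κ :=
    (hasCardinalLT_iff_cardinal_mk_lt _ _).1 (hasCardinalLT_of_hasCardinalLT_arrow hQ)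
  refine ⟨⟨fun {K} => ⟨fun {c} hc => (Types.isLimit_iff _).2 fun s hs => ?_⟩⟩⟩
  choose i a ha using fun q => exists_rep (s q)
  obtain ⟨j₀, hj₀⟩ := hI Q i hQ₀
  have hb : ∀ g : Arrow Q, ∃ (k : I) (h : j₀ ≤ k),
      transition G ((hj₀ g.left).trans h) ≫ a g.left ≫ K.map g.hom =
        transition G ((hj₀ g.right).trans h) ≫ a g.right := by
    intro g
    have h1 : mk G (a g.left ≫ K.map g.hom) = mk G (a g.right) := by
      rw [← map_mk, ha, ha]
      exact hs g.hom
    obtain ⟨k, h₁, h₂, h⟩ := mk_eq_iff.1 h1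
    refine ⟨max k j₀, le_max_right _ _, ?_⟩
    rw [← transition_comp G h₁ (le_max_left k j₀), ← transition_comp G h₂ (le_max_left k j₀),
      Category.assoc, Category.assoc, h]
  choose k hk hkeq using hb
  obtain ⟨j₁, hj₁⟩ := hI (Option (Arrow Q)) (fun g => g.elim j₀ k) (by
    rw [Cardinal.mk_option]
    exact Cardinal.add_lt_of_lt hκ hQ₁ (Cardinal.one_lt_aleph0.trans_le hκ))
  have h₀₁ : j₀ ≤ j₁ := hj₁ none
  have hk₁ : ∀ g, k g ≤ j₁ := fun g => hj₁ (some g)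
  let y : Cone K :=
    { pt := G.obj (Opposite.op j₁)
      π :=
        { app q := transition G ((hj₀ q).trans h₀₁) ≫ a q
          naturality q q' g := by
            have h := hkeq (Arrow.mk g)
            have h' := congrArg (transition G (hk₁ (Arrow.mk g)) ≫ ·) h
            simp only [← Category.assoc, transition_comp] at h'
            exact (Category.id_comp _).trans h'.symm } }
  refine ⟨mk G (hc.lift y), fun q => ?_, fun x hx => ?_⟩
  · refine Eq.trans (congrArg (mk G) (hc.fac y q)) ?_
    exact (mk_transition_comp _ _).trans (ha q)
  · obtain ⟨l, b, rfl⟩ := exists_rep x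
    have hx' : ∀ q, ∃ (k : I) (h₁ : l ≤ k) (h₂ : i q ≤ k),
        transition G h₁ ≫ b ≫ c.π.app q = transition G h₂ ≫ a q := fun q =>
      mk_eq_iff.1 ((hx q).trans (ha q).symm)
    choose n h₁ h₂ hn using hx'
    obtain ⟨j₂, hj₂⟩ := hI Q n hQ₀
    refine mk_eq_iff.2 ⟨max l (max j₁ j₂), le_max_left _ _,
      (le_max_left _ _).trans (le_max_right _ _), hc.hom_ext fun q => ?_⟩
    have hq : n q ≤ max l (max j₁ j₂) := (hj₂ q).trans ((le_max_right _ _).trans (le_max_right _ _))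
    have h := congrArg (transition G hq ≫ ·) (hn q)
    simp only [← Category.assoc, transition_comp] at h
    rw [Category.assoc, Category.assoc, hc.fac, ← Category.assoc, h]
    change _ = _ ≫ transition G _ ≫ a q
    rw [← Category.assoc, transition_comp]

end colimitModel

end ColimitModel

/-! ### From covering sieves to extremal epimorphic families -/

section Sheaves

/-- Sheaves of sets form a balanced category, so it is enough that `m` is epi. By adjunction and
Yoneda, two arrows equalised by `m` are sections of a sheaf over `x₀` that agree on a covering
sieve. -/
lemma isExtremalEpimorphic_of_mem {C : Type u} [SmallCategory C] (T : GrothendieckTopology C)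
    {ι : Type*} {x₀ : C} (U : ι → C) (f : ∀ i, U i ⟶ x₀)
    (h : Sieve.generate (Presieve.ofArrows U f) ∈ T x₀) :
    IsExtremalEpimorphic (Presieve.ofArrows
      (fun i => (yoneda ⋙ presheafToSheaf T (Type u)).obj (U i))
      (fun i => (yoneda ⋙ presheafToSheaf T (Type u)).map (f i))) := by
  intro Z m _ hm
  have : Epi m := by
    refine ⟨fun {W} a b hab => ?_⟩
    let adj := sheafificationAdjunction T (Type u)
    have key : ∀ i, (presheafToSheaf T (Type u)).map (yoneda.map (f i)) ≫ a =
        (presheafToSheaf T (Type u)).map (yoneda.map (f i)) ≫ b := by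
      intro i
      obtain ⟨g, hg⟩ := hm _ (Presieve.ofArrows.mk i)
      have hg' : (presheafToSheaf T (Type u)).map (yoneda.map (f i)) = g ≫ m := hg.symm
      rw [hg', Category.assoc, Category.assoc, hab]
    apply (adj.homEquiv _ _).injective
    apply yonedaEquiv.injective
    refine (((isSheaf_iff_isSheaf_of_type _ _).1 W.2).isSeparated _ h).ext ?_
    rintro Y _ ⟨_, k, _, ⟨i⟩, rfl⟩
    have h' := congrArg (fun z => yonedaEquiv (adj.homEquiv _ _ z)) (key i)
    simp only [Adjunction.homEquiv_naturality_left, ← yonedaEquiv_naturality] at h'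
    rw [op_comp, Functor.map_comp]
    exact congrArg (W.obj.map k.op) h'
  exact isIso_of_mono_of_epi m

end Sheaves

/-! ### Exhaustive strategies and preservation of families -/

section Completeness

variable {C : Type u} [SmallCategory C] {E : Precoverage C}

lemma mk_task_le {κ : Cardinal.{u}} (hκ : Cardinal.aleph0 ≤ κ)
    (hcard : Cardinal.mk (Σ X : C, E X) ≤ κ) (hhom : ∀ X Y : C, Cardinal.mk (X ⟶ Y) ≤ κ) (X : C) :
    Cardinal.mk (Task E X) ≤ κ := by
  rw [Cardinal.mk_sigma]
  calc Cardinal.sum (fun R : Σ Y : C, E Y => Cardinal.mk (X ⟶ R.1))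
      ≤ Cardinal.sum (fun _ : Σ Y : C, E Y => κ) := Cardinal.sum_le_sum _ _ fun R => hhom X R.1
    _ = Cardinal.mk (Σ Y : C, E Y) * κ := Cardinal.sum_const' _ _
    _ ≤ κ * κ := mul_le_mul_left hcard κ
    _ = κ := Cardinal.mul_eq_self hκ

/-- There is a strategy that deals with all tasks for the objects of a run. -/
lemma exists_exhaustive_strategy {J : Type u} [LinearOrder J]
    (hJ : Cardinal.aleph0 ≤ Cardinal.mk J)
    (hJlt : ∀ a : J, Cardinal.mk (Set.Iio a) < Cardinal.mk J)
    (hne : ∀ X, Nonempty (Task E X)) (hcard : ∀ X, Cardinal.mk (Task E X) ≤ Cardinal.mk J) :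
    ∃ σ : Strategy E J, ∀ (a : J) (X : C) (t : Task E X), ∃ b, σ.look b = a ∧ σ.task b X = t := by
  have hsurj : ∀ X, ∃ e : J → Task E X, Function.Surjective e := by
    intro X
    obtain ⟨i⟩ := hcard X
    have := hne X
    exact ⟨Function.invFun i, Function.invFun_surjective i.injective⟩
  choose e he using hsurj
  -- The coordinates code the earlier stage, the task, and a dummy that makes each pair recur `#J`
  -- times.
  obtain ⟨φ⟩ : Nonempty (J ≃ J × J × J) := by
    rw [← Cardinal.eq]
    simp [Cardinal.mk_prod, Cardinal.mul_eq_self hJ]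
  refine ⟨⟨fun b => min (φ b).1 b, fun b => min_le_right _ _, fun b X => e X (φ b).2.1⟩, ?_⟩
  intro a X t
  obtain ⟨x, rfl⟩ := he X t
  -- Fewer than `#J` stages precede `a`, so some recurrence comes at or after `a`, where the `min`
  -- in `look` has no effect.
  obtain ⟨z, hz⟩ : ∃ z, a ≤ φ.symm (a, x, z) := by
    by_contra! h
    refine (hJlt a).not_ge (Cardinal.mk_le_of_injective
      (f := fun z => (⟨φ.symm (a, x, z), h z⟩ : Set.Iio a)) fun z z' hzz => ?_)
    have := φ.symm.injective (congrArg Subtype.val hzz)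
    simpa using this
  exact ⟨φ.symm (a, x, z), by simpa using hz, by simp⟩

variable {J : Type u} [LinearOrder J] [OrderBot J] [SuccOrder J] {σ : Strategy E J}
  {P : MorphismProperty C} {x₀ : C}

lemma IsStep.of_eq {Q : Type u} [Preorder Q] {D : Qᵒᵖ ⥤ C} {t : ∀ X, Task E X}
    {a b c : Q} {hab : a ≤ b} {hbc : b ≤ c} (H : IsStep D t hab hbc) {X : C} {R : Presieve X}
    (hR : R ∈ E X) (g : D.obj (Opposite.op a) ⟶ X) (ht : t _ = ⟨⟨X, R, hR⟩, g⟩) :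
    ∃ (Z : C) (f : Z ⟶ X) (q : D.obj (Opposite.op c) ⟶ Z), R f ∧
      IsPullback (D.map (homOfLE hbc).op) q (D.map (homOfLE hab).op ≫ g) f := by
  unfold IsStep at H
  rw [ht] at H
  exact H

/-- The model given by a complete run of an exhaustive strategy preserves the families in `E`. -/
lemma IsRun.preservesFamilies
    (hσ : ∀ (a : J) (X : C) (t : Task E X), ∃ b, σ.look b = a ∧ σ.task b X = t)
    {D : ((⊤ : LowerSet J))ᵒᵖ ⥤ C} (hD : IsRun σ P x₀ ⊤ D) :
    PreservesFamilies E (colimitModel D) := by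
  intro X R hR Z m _ hm
  refine (isIso_iff_bijective m).2 ⟨(mono_iff_injective m).1 inferInstance, fun y => ?_⟩
  obtain ⟨⟨a, ha⟩, g, rfl⟩ := colimitModel.exists_rep y
  -- Stage `b` carries out the task given by `R` and `g`. The pullback square at the next stage
  -- supplies `q`, which represents a preimage of the class of `g`.
  obtain ⟨b, rfl, hb⟩ := hσ a _ ⟨⟨X, R, hR⟩, g⟩
  obtain ⟨W, f, q, hf, hq⟩ := (hD.step b trivial).of_eq hR g hb
  obtain ⟨h, hh⟩ := hm _ (Presieve.map.of hf)
  refine ⟨h (colimitModel.mk D q), ?_⟩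
  have h1 : m (h (colimitModel.mk D q)) = (colimitModel D).map f (colimitModel.mk D q) :=
    ConcreteCategory.congr_hom hh _
  rw [h1, colimitModel.map_mk, ← hq.w]
  exact (colimitModel.mk_transition_comp _ _).trans (colimitModel.mk_transition_comp _ _)

end Completeness

end LexSite

/-! ### The completeness theorem -/

theorem mainTheorem8 {C : Type u} [SmallCategory C] (κ : Cardinal.{u}) (E : Precoverage C)
    (hE : LexSite.IsSite κ E)
    (hcard : Cardinal.mk (Σ X : C, E X) ≤ κ)
    (hhom : ∀ X Y : C, Cardinal.mk (X ⟶ Y) ≤ κ)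
    {ι : Type*} {x₀ : C} (U : ι → C) (f : ∀ i, U i ⟶ x₀)
    (hf : ∀ M : C ⥤ Type u, LexSite.IsLexFunctor κ M → LexSite.PreservesFamilies E M →
      ∀ y : M.obj x₀, ∃ (i : ι) (x : M.obj (U i)), M.map (f i) x = y) :
    LexSite.IsExtremalEpimorphic
      (Presieve.ofArrows (fun i => (LexSite.ay κ E).obj (U i))
        (fun i => (LexSite.ay κ E).map (f i))) := by
  have hκ := hE.isRegular.aleph0_le
  have : Fact κ.IsRegular := ⟨hE.isRegular⟩
  have : Nonempty κ.ord.ToType := Cardinal.nonempty_ord_toType hE.isRegular.ne_zero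
  have : NoMaxOrder κ.ord.ToType := Cardinal.noMaxOrder hκ
  let : OrderBot κ.ord.ToType := WellFoundedLT.toOrderBot _
  let : SuccOrder κ.ord.ToType := SuccOrder.ofLinearWellFoundedLT _
  obtain ⟨σ, hσ⟩ := LexSite.exists_exhaustive_strategy (E := E) (J := κ.ord.ToType)
    (by simpa using hκ)
    (fun a => Cardinal.mk_Iio_lt a (by simp))
    -- The family `{id : 1 ⟶ 1}` provides every object with at least one task.
    (fun X => by
      obtain ⟨Y, ⟨hY⟩, h⟩ := hE.id_mem
      exact ⟨⟨⟨Y, _, h⟩, hY.from X⟩⟩)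
    (fun X => (LexSite.mk_task_le hκ hcard hhom X).trans_eq (Cardinal.mk_ord_toType κ).symm)
  refine LexSite.isExtremalEpimorphic_of_mem _ U f
    (LexSite.mem_topology_of_forall_not_isRun (σ := σ) hE.isLexCategory hκ (fun a => ?_) _ fun D hD => ?_)
  · exact (Cardinal.mk_le_mk_of_subset fun x (hx : x ≤ a) => Order.lt_succ_of_le hx).trans_lt
      ((Cardinal.mk_Iio_lt (Order.succ a) (by simp)).trans_eq (Cardinal.mk_ord_toType κ))
  · have hlex : LexSite.IsLexFunctor κ (LexSite.colimitModel D) := LexSite.colimitModel.isLexFunctor D hκ fun K s hK =>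
      have hK' := (hasCardinalLT_iff_cardinal_mk_lt K κ).2 hK
      ⟨⟨IsCardinalFiltered.max (fun k => (s k).1) hK', trivial⟩,
        fun k => leOfHom (IsCardinalFiltered.toMax (fun k => (s k).1) hK' k)⟩
    -- The generic element of the model at `x₀`, represented at the root.
    obtain ⟨i, x, hx⟩ := hf (LexSite.colimitModel D) hlex (hD.preservesFamilies hσ)
      (LexSite.colimitModel.mk D (eqToHom (hD.root trivial)))
    obtain ⟨b, g, rfl⟩ := LexSite.colimitModel.exists_rep x
    obtain ⟨k, hb, h0, h⟩ := LexSite.colimitModel.mk_eq_iff.1 hx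
    -- At stage `k` the arrow to the root factors through `f i`, so it lies in the sieve.
    refine hD.unstopped k.1 trivial ⟨hD.root trivial, ?_⟩
    have h' : D.map (homOfLE h0).op ≫ eqToHom (hD.root trivial) =
        (LexSite.transition D hb ≫ g) ≫ f i := h.symm.trans (Category.assoc _ _ _).symm
    change Sieve.generate _ (D.map (homOfLE h0).op ≫ eqToHom (hD.root trivial))
    rw [h']
    exact ⟨_, _, _, Presieve.ofArrows.mk i, rfl⟩
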